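/- Let $L$ be a first-order language and let $\mathcal U$ be a saturated $L$-structure whose cardinality $\kappa$ is (uncountable, strongly) inaccessible and larger than $|L|$. Let $z$ be a finite tuple of variables and let $\mathcal D\subseteq\mathcal U^{|z|}$ be an arbitrary set. For an $L$-formula $\varphi(x,z)$ without parameters ($x$ a finite tuple), $b\in\mathcal U^{|x|}$ and $B\subseteq\mathcal U$, write $\varphi(b,\mathcal U)=\{a\in\mathcal U^{|z|}:\mathcal U\models\varphi(b,a)\}$ and $\varphi(b,B)=\varphi(b,\mathcal U)\cap B^{|z|}$. We say that $\mathcal D$ is *approximable by* $\varphi(x,z)$ if for every finite $B\subseteq\mathcal U$ there is $b\in\mathcal U^{|x|}$ such that $\varphi(b,B)=\mathcal D\cap B^{|z|}$, and that $\mathcal D$ is *approximable from below by* $\varphi(x,z)$ if for every finite $B\subseteq\mathcal U$ there is $b\in\mathcal U^{|x|}$ such that $\varphi(b,B)=\mathcal D\cap B^{|z|}$ and $\varphi(b,\mathcal U)\subseteq\mathcal D$. We say that $\mathcal D$ is *approximable from below* if it is so by some $L$-formula. The formula $\varphi(x,z)$ is *NIP* if the family $\{\varphi(a,\mathcal U):a\in\mathcal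 U^{|x|}\}$ has finite VC-dimension, that is, if there is $d<\omega$ such that for no set $S\subseteq\mathcal U^{|z|}$ of size $d$ is every subset of $S$ of the form $\varphi(a,\mathcal U)\cap S$ with $a\in\mathcal U^{|x|}$. **Corollary.** If $\mathcal D$ is approximable by some NIP formula $\varphi(x,z)$, then $\mathcal D$ is approximable from below, that is, there is an $L$-formula $\psi(y,z)$, with $y$ a finite tuple possibly of a different length than $x$, such that $\mathcal D$ is approximable from below by $\psi(y,z)$. (No other assumption on the theory of $\mathcal U$ is made; in particular it need not be NIP.) -/

import Mathlib

open scoped FirstOrder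

universe u v w

namespace Approx

/-- The power `B ^ n`: the `n`-tuples all of whose entries lie in `B`. -/
def power {U : Type w} (B : Set U) (n : ℕ) : Set (Fin n → U) :=
  {a | ∀ i, a i ∈ B}

/-- The set `φ(b, U) = {a : U ⊨ φ(b, a)}` defined by the instance `φ(b, z)` of a formula `φ(x, z)`,
where `x` is an `m`-tuple and `z` an `n`-tuple of variables. -/
def instanceSet {L : FirstOrder.Language.{u, v}} {U : Type w} [L.Structure U] {m n : ℕ}
    (φ : L.Formula (Fin m ⊕ Fin n)) (b : Fin m → U) : Set (Fin n → U) :=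
  {a | φ.Realize (Sum.elim b a)}

/-- `D` is approximable by `φ(x, z)`: for every finite `B ⊆ U` there is a tuple `b` with
`φ(b, B) = D ∩ B ^ |z|`. -/
def ApproximableBy {L : FirstOrder.Language.{u, v}} {U : Type w} [L.Structure U] {m n : ℕ}
    (D : Set (Fin n → U)) (φ : L.Formula (Fin m ⊕ Fin n)) : Prop :=
  ∀ B : Set U, B.Finite → ∃ b : Fin m → U,
    instanceSet φ b ∩ power B n = D ∩ power B n

/-- `D` is approximable from below by `φ(x, z)`: for every finite `B ⊆ U` there is a tuple `b` with
`φ(b, B) = D ∩ B ^ |z|` and `φ(b, U) ⊆ D`. -/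
def ApproximableFromBelowBy {L : FirstOrder.Language.{u, v}} {U : Type w} [L.Structure U] {m n : ℕ}
    (D : Set (Fin n → U)) (φ : L.Formula (Fin m ⊕ Fin n)) : Prop :=
  ∀ B : Set U, B.Finite → ∃ b : Fin m → U,
    instanceSet φ b ∩ power B n = D ∩ power B n ∧ instanceSet φ b ⊆ D

/-- `D` is approximable from below: it is so by some formula `ψ(y, z)` of the language (without
parameters), with `y` a finite tuple of any length. -/
def ApproximableFromBelow (L : FirstOrder.Language.{u, v}) {U : Type w} [L.Structure U] {n : ℕ}
    (D : Set (Fin n → U)) : Prop :=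
  ∃ (k : ℕ) (ψ : L.Formula (Fin k ⊕ Fin n)), ApproximableFromBelowBy D ψ

/-- A family `F` of subsets of `X` shatters `B ⊆ X` if every subset of `B` is the trace on `B` of
some member of `F`. -/
def Shatters {X : Type w} (F : Set (Set X)) (B : Set X) : Prop :=
  ∀ H : Set X, H ⊆ B → ∃ C ∈ F, C ∩ B = H

/-- `F` has finite VC-dimension: for some `d`, no set of size `d` is shattered by `F`. -/
def FiniteVCDim {X : Type w} (F : Set (Set X)) : Prop :=
  ∃ d : ℕ, ∀ B : Finset X, B.card = d → ¬ Shatters F (B : Set X)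

/-- `φ(x, z)` is NIP in `U`: the family of the sets `φ(a, U)` has finite VC-dimension. -/
def IsNIP {L : FirstOrder.Language.{u, v}} (U : Type w) [L.Structure U] {m n : ℕ}
    (φ : L.Formula (Fin m ⊕ Fin n)) : Prop :=
  FiniteVCDim (Set.range fun a : Fin m → U => instanceSet φ a)

/-- `U` is saturated: every type `p(x)` in finitely many variables over a set of parameters
`A ⊆ U` of cardinality less than `|U|` which is finitely satisfiable in `U` is realized in `U`. -/
def IsSaturated (L : FirstOrder.Language.{u, v}) (U : Type w) [L.Structure U] : Prop :=
  ∀ A : Set U, Cardinal.mk A < Cardinal.mk U →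
    ∀ (k : ℕ) (p : Set (L[[A]].Formula (Fin k))),
      (∀ q ⊆ p, q.Finite → ∃ a : Fin k → U, ∀ θ ∈ q, θ.Realize a) →
        ∃ a : Fin k → U, ∀ θ ∈ p, θ.Realize a

end Approx

/-!
Call a set `P` inner approximable in `D` if, for a single formula, every finite subset of `P` lies
in an instance of the formula that is contained in `D`. The inner approximable sets form an ideal,
and if `D` belongs to this ideal, then `D` is approximable from below. If it does not, there is an
ultrafilter `p` containing `D` and avoiding the ideal.

Let `R` be a definable relation on `j`-tuples that belongs to the iterated power of `p`. Then `R`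
contains tuples with any prescribed trace on `D`. Indeed, assume by induction that the last `j - 1`
coordinates can be chosen, with the prescribed trace, to satisfy finitely many instances `R(a, ·)`
simultaneously. If a first coordinate outside `D` were then never available, the sets `R(·, v)`
would witness that `{a | R(a, ·) holds almost everywhere}`, a member of `p`, is inner approximable.

Apply this to the complement of the relation saying that some instance of `φ` cuts out the pattern
`σ` on the tuple. As `φ` approximates `D`, every tuple with trace `σ` on `D` satisfies it,
so the relation itself belongs to the power of `p`. This holds for each of the finitely many `σ`, so
almost every tuple is shattered by the instances of `φ`, whatever its length, which contradicts NIP.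
-/

namespace Approx

open FirstOrder FirstOrder.Language Set

variable {L : FirstOrder.Language.{u, v}} {U : Type w} [L.Structure U]

section Definability

variable {α β ι : Type*} {A : Set U}

theorem definable_setOf_elim_comp_mem {s : Set (α → U)} (hs : A.Definable L s) (f : α → A ⊕ β) :
    A.Definable L {v : β → U | Sum.elim (↑) v ∘ f ∈ s} := by
  obtain ⟨φ, rfl⟩ := definable_iff_exists_formula_sum.1 hs
  refine definable_iff_exists_formula_sum.2 ⟨φ.relabel (Sum.elim Sum.inl f), ?_⟩
  ext v
  simp only [mem_ofPred_eq, Formula.realize_relabel, Sum.comp_elim, Sum.elim_comp_inl]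

theorem exists_definable_fin_preimage_elim_comp {s : Set (α ⊕ β → U)} (hs : A.Definable L s) :
    ∃ (k : ℕ) (e : Fin k → α) (t : Set (Fin k ⊕ β → U)), A.Definable L t ∧
      ∀ d : α → U, Sum.elim (d ∘ e) ⁻¹' t = Sum.elim d ⁻¹' s := by
  classical
  obtain ⟨φ, rfl⟩ := hs
  let vars : Finset α := φ.freeVarFinset.toLeft
  let f : φ.freeVarFinset → Fin vars.card ⊕ β := fun x =>
    match x with
    | ⟨Sum.inl i, hi⟩ => Sum.inl (vars.equivFin ⟨i, Finset.mem_toLeft.2 hi⟩)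
    | ⟨Sum.inr i, _⟩ => Sum.inr i
  refine ⟨vars.card, fun i => vars.equivFin.symm i, _, ⟨φ.restrictFreeVar f, rfl⟩, fun d => ?_⟩
  ext a
  refine BoundedFormula.realize_restrictFreeVar _ ?_
  rintro ⟨x | x, hx⟩ <;> simp [f]

theorem exists_empty_definable_preimage_elim {s : Set (α ⊕ β → U)} (hs : A.Definable L s) :
    ∃ (k : ℕ) (t : Set (Fin k ⊕ β → U)), (∅ : Set U).Definable L t ∧
      ∀ d : α → U, ∃ e : Fin k → U, Sum.elim e ⁻¹' t = Sum.elim d ⁻¹' s := by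
  obtain ⟨φ, rfl⟩ := definable_iff_exists_formula_sum.1 hs
  have hφ : (∅ : Set U).Definable L
      {v : (A ⊕ α) ⊕ β → U | φ.Realize (v ∘ (Equiv.sumAssoc A α β).symm)} :=
    (empty_definable_iff.2 ⟨φ, rfl⟩).preimage_comp _
  obtain ⟨k, e, t, ht, hte⟩ := exists_definable_fin_preimage_elim_comp hφ
  refine ⟨k, t, ht, fun d => ⟨Sum.elim (↑) d ∘ e, (hte _).trans ?_⟩⟩
  ext a
  refine iff_of_eq (congrArg φ.Realize (funext ?_))
  rintro (c | i | i) <;> rfl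

theorem definable_curry_preimage_vecCons {j : ℕ} {R : Set (Fin (j + 1) → β → U)}
    (hR : A.Definable L (Function.curry ⁻¹' R)) {a : β → U} (ha : ∀ t, a t ∈ A) :
    A.Definable L (Function.curry ⁻¹' (Matrix.vecCons a ⁻¹' R)) := by
  convert definable_setOf_elim_comp_mem hR (β := Fin j × β) fun q =>
    Fin.cases (Sum.inl ⟨a q.2, ha q.2⟩) (fun i => Sum.inr (i, q.2)) q.1 using 1
  ext v
  refine iff_of_eq (congrArg (· ∈ R) (funext fun i => funext fun t => ?_))
  cases i using Fin.cases <;> rfl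

theorem definable_setOf_vecCons_curry_mem {j : ℕ} {R : Set (Fin (j + 1) → β → U)}
    (hR : A.Definable L (Function.curry ⁻¹' R)) :
    A.Definable L {w : (Fin j × β) ⊕ β → U |
      Matrix.vecCons (w ∘ Sum.inr) (Function.curry (w ∘ Sum.inl)) ∈ R} := by
  convert hR.preimage_comp (β := (Fin j × β) ⊕ β) fun q =>
    Fin.cases (Sum.inr q.2) (fun i => Sum.inl (i, q.2)) q.1 using 1
  ext w
  refine iff_of_eq (congrArg (· ∈ R) (funext fun i => funext fun t => ?_))
  cases i using Fin.cases <;> rfl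

theorem definable_curry_setOf_exists_preimage_eq [Finite ι] {m : ℕ} {t : Set (Fin m ⊕ β → U)}
    (ht : A.Definable L t) (σ : Set ι) :
    A.Definable L (Function.curry ⁻¹'
      {v : ι → β → U | ∃ b : Fin m → U, v ⁻¹' (Sum.elim b ⁻¹' t) = σ}) := by
  let instanceAt (i : ι) : Set ((ι × β) ⊕ Fin m → U) :=
    (· ∘ Sum.elim Sum.inr fun x => Sum.inl (i, x)) ⁻¹' t
  have mem_instanceAt (v : ι × β → U) (b : Fin m → U) (i : ι) :
      Sum.elim v b ∈ instanceAt i ↔ Function.curry v i ∈ Sum.elim b ⁻¹' t :=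
    iff_of_eq (congrArg (· ∈ t) (Sum.comp_elim _ _ _))
  have definable_instanceAt (i : ι) : A.Definable L (instanceAt i) := ht.preimage_comp _
  have definable_pattern (i : ι) : A.Definable L {w | w ∈ instanceAt i ↔ i ∈ σ} := by
    by_cases hi : i ∈ σ
    · simpa only [hi, iff_true] using! definable_instanceAt i
    · simpa only [hi, iff_false] using! (definable_instanceAt i).compl
  convert (definable_iInter_of_finite definable_pattern).image_comp_sumInl_fin m using 1
  ext v
  constructor
  · rintro ⟨b, hb⟩
    exact ⟨Sum.elim v b, mem_iInter.2 fun i => (mem_instanceAt v b i).trans (Set.ext_iff.1 hb i),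
      Sum.elim_comp_inl v b⟩
  · rintro ⟨w, hw, rfl⟩
    rw [← Sum.elim_comp_inl_inr w] at hw
    exact ⟨w ∘ Sum.inr, ext fun i => (mem_instanceAt _ _ i).symm.trans (mem_iInter.1 hw i)⟩

end Definability

/-- `P` is inner approximable in `D` if, for some parameter-free definable set, every finite subset
of `P` lies in a fibre of this set that is contained in `D`. The set `D` itself is approximable from
below as soon as it is inner approximable in `D`; allowing smaller sets `P` gives an ideal. -/
def InnerApproximable (L : FirstOrder.Language.{u, v}) {U : Type w} [L.Structure U] {β : Type*}
    (D P : Set (β → U)) : Prop :=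
  ∃ (k : ℕ) (t : Set (Fin k ⊕ β → U)), (∅ : Set U).Definable L t ∧
    ∀ S ⊆ P, S.Finite → ∃ b : Fin k → U, S ⊆ Sum.elim b ⁻¹' t ∧ Sum.elim b ⁻¹' t ⊆ D

namespace InnerApproximable

variable {α β : Type*} {D P Q : Set (β → U)}

theorem of_definable {A : Set U} {s : Set (α ⊕ β → U)} (hs : A.Definable L s)
    (h : ∀ S ⊆ P, S.Finite → ∃ d : α → U, S ⊆ Sum.elim d ⁻¹' s ∧ Sum.elim d ⁻¹' s ⊆ D) :
    InnerApproximable L D P := by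
  obtain ⟨k, t, ht, hts⟩ := exists_empty_definable_preimage_elim hs
  refine ⟨k, t, ht, fun S hSP hS => ?_⟩
  obtain ⟨d, hd⟩ := h S hSP hS
  obtain ⟨e, he⟩ := hts d
  exact ⟨e, by rwa [he]⟩

theorem mono (hQ : InnerApproximable L D Q) (hPQ : P ⊆ Q) : InnerApproximable L D P := by
  obtain ⟨k, t, ht, h⟩ := hQ
  exact ⟨k, t, ht, fun S hSP => h S (hSP.trans hPQ)⟩

theorem empty : InnerApproximable L D ∅ :=
  ⟨0, ∅, definable_empty, fun _ hS _ => ⟨Fin.elim0, hS, empty_subset D⟩⟩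

theorem union (hP : InnerApproximable L D P) (hQ : InnerApproximable L D Q) :
    InnerApproximable L D (P ∪ Q) := by
  obtain ⟨k, t, ht, hP⟩ := hP
  obtain ⟨l, r, hr, hQ⟩ := hQ
  refine of_definable ((ht.preimage_comp (Sum.map (Sum.inl : Fin k → Fin k ⊕ Fin l) id)).union
    (hr.preimage_comp (Sum.map Sum.inr id))) fun S hSPQ hS => ?_
  obtain ⟨b, hSb, hbD⟩ := hP (S ∩ P) inter_subset_right (hS.inter_of_left P)
  obtain ⟨c, hSc, hcD⟩ := hQ (S ∩ Q) inter_subset_right (hS.inter_of_left Q)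
  refine ⟨Sum.elim b c, ?_⟩
  simp only [preimage_union, preimage_preimage, Sum.elim_comp_map, Sum.elim_comp_inl,
    Sum.elim_comp_inr, Function.comp_id]
  refine ⟨?_, union_subset hbD hcD⟩
  rw [← inter_eq_left.2 hSPQ, inter_union_distrib_left]
  exact union_subset_union hSb hSc

theorem approximableFromBelow {n : ℕ} {D : Set (Fin n → U)} (h : InnerApproximable L D D) :
    ApproximableFromBelow L D := by
  obtain ⟨k, t, ht, h⟩ := h
  obtain ⟨ψ, rfl⟩ := empty_definable_iff.1 ht
  refine ⟨k, ψ, fun B hB => ?_⟩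
  have hBn : (power B n).Finite := Finite.pi' fun _ => hB
  obtain ⟨b, hb, hbD⟩ := h (D ∩ power B n) inter_subset_left (hBn.inter_of_right D)
  exact ⟨b, Subset.antisymm (inter_subset_inter_left _ hbD)
    (subset_inter hb inter_subset_right), hbD⟩

end InnerApproximable

theorem exists_ultrafilter_mem_and_forall_mem_not {X : Type*} {I : Set X → Prop} (hempty : I ∅)
    (hmono : ∀ t, I t → ∀ s ⊆ t, I s) (hunion : ∀ s, I s → ∀ t, I t → I (s ∪ t)) {D : Set X}
    (hD : ¬ I D) : ∃ p : Ultrafilter X, D ∈ p ∧ ∀ P ∈ p, ¬ I P := by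
  let F : Filter X := Filter.comk I hempty hmono hunion
  have : (F ⊓ Filter.principal D).NeBot := by
    rwa [Filter.neBot_iff, Ne, Filter.inf_principal_eq_bot, Filter.compl_mem_comk]
  obtain ⟨p, hp⟩ := Ultrafilter.exists_le (F ⊓ Filter.principal D)
  refine ⟨p, hp (Filter.mem_inf_of_right (Filter.mem_principal_self D)), fun P hPp hP => ?_⟩
  have hPc : Pᶜ ∈ p := hp (Filter.mem_inf_of_left (Filter.compl_mem_comk.2 hP))
  exact Ultrafilter.compl_mem_iff_notMem.1 hPc hPp

/-- The iterated Fubini power of an ultrafilter, an ultrafilter on `j`-tuples. The first coordinate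
is the outermost one: almost all `j + 1`-tuples have a property if for almost all `a`, for almost
all `j`-tuples `v`, the tuple `(a, v)` has it. -/
def ultrafilterPower {X : Type*} (p : Ultrafilter X) : (j : ℕ) → Ultrafilter (Fin j → X)
  | 0 => pure Fin.elim0
  | j + 1 => p.bind fun a => (ultrafilterPower p j).map (Matrix.vecCons a)

theorem mem_ultrafilterPower_succ {X : Type*} {p : Ultrafilter X} {j : ℕ}
    {R : Set (Fin (j + 1) → X)} :
    R ∈ ultrafilterPower p (j + 1) ↔ {a | Matrix.vecCons a ⁻¹' R ∈ ultrafilterPower p j} ∈ p :=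
  Iff.rfl

section Traces

variable {β : Type*} {D P : Set (β → U)}

theorem exists_vecCons_mem_and_notMem {j : ℕ} {A : Set U} {R : Set (Fin (j + 1) → β → U)}
    (hR : A.Definable L (Function.curry ⁻¹' R)) (hP : ¬ InnerApproximable L D P)
    {V : Set (Fin j → β → U)}
    (hV : ∀ S ⊆ P, S.Finite → ∃ v ∈ V, ∀ a ∈ S, Matrix.vecCons a v ∈ R) :
    ∃ v ∈ V, ∃ a ∉ D, Matrix.vecCons a v ∈ R := by
  by_contra! hVD
  refine hP (.of_definable (definable_setOf_vecCons_curry_mem hR) fun S hSP hS => ?_)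
  obtain ⟨v, hv, hSv⟩ := hV S hSP hS
  exact ⟨Function.uncurry v, hSv, fun a ha => not_not.1 fun haD => hVD v hv a haD ha⟩

theorem exists_mem_preimage_eq_of_mem_ultrafilterPower {p : Ultrafilter (β → U)} (hDp : D ∈ p)
    (hp : ∀ P ∈ p, ¬ InnerApproximable L D P) {j : ℕ} {R : Set (Fin j → β → U)}
    (hR : (univ : Set U).Definable L (Function.curry ⁻¹' R)) (hRp : R ∈ ultrafilterPower p j)
    (σ : Set (Fin j)) : ∃ v ∈ R, v ⁻¹' D = σ := by
  induction j with
  | zero => exact ⟨Fin.elim0, hRp, Subsingleton.elim _ _⟩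
  | succ j ih =>
    let σ' : Set (Fin j) := Fin.succ ⁻¹' σ
    let P : Set (β → U) := {a | Matrix.vecCons a ⁻¹' R ∈ ultrafilterPower p j}
    have hPp : P ∈ p := mem_ultrafilterPower_succ.1 hRp
    have exists_tail (S : Set (β → U)) (hSP : S ⊆ P) (hS : S.Finite) :
        ∃ v : Fin j → β → U, v ⁻¹' D = σ' ∧ ∀ a ∈ S, Matrix.vecCons a v ∈ R := by
      have : Finite S := hS
      obtain ⟨v, hv, hvD⟩ := ih (R := ⋂ a : S, Matrix.vecCons (a : β → U) ⁻¹' R)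
        (by
          simp only [preimage_iInter]
          exact definable_iInter_of_finite fun a =>
            definable_curry_preimage_vecCons hR fun _ => mem_univ _)
        (Filter.iInter_mem.2 fun a => hSP a.2) σ'
      exact ⟨v, hvD, fun a ha => mem_iInter.1 hv ⟨a, ha⟩⟩
    obtain ⟨v, hv, a, ha, hav⟩ : ∃ v : Fin j → β → U, v ⁻¹' D = σ' ∧
        ∃ a, (a ∈ D ↔ 0 ∈ σ) ∧ Matrix.vecCons a v ∈ R := by
      by_cases h0 : 0 ∈ σ
      · obtain ⟨a, haP, haD⟩ := p.nonempty_of_mem (Filter.inter_mem hPp hDp)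
        obtain ⟨v, hv, hav⟩ := exists_tail {a} (singleton_subset_iff.2 haP) (finite_singleton a)
        exact ⟨v, hv, a, iff_of_true haD h0, hav a rfl⟩
      · obtain ⟨v, hv, a, haD, hav⟩ :=
          exists_vecCons_mem_and_notMem hR (hp P hPp) (V := {v | v ⁻¹' D = σ'}) exists_tail
        exact ⟨v, hv, a, iff_of_false haD h0, hav⟩
    exact ⟨_, hav, ext <| Fin.cases ha fun i => Set.ext_iff.1 hv i⟩

end Traces

theorem ApproximableBy.exists_preimage_instanceSet_eq {ι : Type*} [Finite ι] {m n : ℕ}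
    {D : Set (Fin n → U)} {φ : L.Formula (Fin m ⊕ Fin n)} (h : ApproximableBy D φ)
    (v : ι → Fin n → U) : ∃ b, v ⁻¹' instanceSet φ b = v ⁻¹' D := by
  obtain ⟨b, hb⟩ := h (range (Function.uncurry v)) (finite_range _)
  refine ⟨b, ext fun i => ?_⟩
  have hi : v i ∈ power (range (Function.uncurry v)) n := fun t => ⟨(i, t), rfl⟩
  simpa only [mem_preimage, mem_inter_iff, hi, and_true] using Set.ext_iff.1 hb (v i)

theorem ApproximableBy.setOf_exists_preimage_eq_mem_ultrafilterPower {m n j : ℕ}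
    {D : Set (Fin n → U)} {φ : L.Formula (Fin m ⊕ Fin n)} (hD : ApproximableBy D φ)
    {p : Ultrafilter (Fin n → U)} (hDp : D ∈ p) (hp : ∀ P ∈ p, ¬ InnerApproximable L D P)
    (σ : Set (Fin j)) :
    {v : Fin j → Fin n → U | ∃ b, v ⁻¹' instanceSet φ b = σ} ∈ ultrafilterPower p j := by
  set R : Set (Fin j → Fin n → U) := {v | ∃ b, v ⁻¹' instanceSet φ b = σ}
  have hφ : (univ : Set U).Definable L {v | φ.Realize v} :=
    (empty_definable_iff.2 ⟨φ, rfl⟩).mono (empty_subset _)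
  have hR : (univ : Set U).Definable L (Function.curry ⁻¹' R) :=
    definable_curry_setOf_exists_preimage_eq hφ σ
  by_contra hσ
  obtain ⟨v, hv, hvD⟩ := exists_mem_preimage_eq_of_mem_ultrafilterPower hDp hp (R := Rᶜ) hR.compl
    (Ultrafilter.compl_mem_iff_notMem.2 hσ) σ
  obtain ⟨b, hb⟩ := hD.exists_preimage_instanceSet_eq v
  exact hv ⟨b, hb.trans hvD⟩

section Shattering

variable {X : Type w} {ι : Type*} {F : Set (Set X)} {v : ι → X}

theorem injective_of_forall_exists_preimage_eq (h : ∀ σ : Set ι, ∃ C ∈ F, v ⁻¹' C = σ) :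
    Function.Injective v := fun i i' hii' => by
  obtain ⟨C, -, hC⟩ := h {i}
  have hi : v i ∈ C := hC.ge (mem_singleton i)
  exact (hC.le (show v i' ∈ C from hii' ▸ hi)).symm

theorem shatters_range_of_forall_exists_preimage_eq (h : ∀ σ : Set ι, ∃ C ∈ F, v ⁻¹' C = σ) :
    Shatters F (range v) := fun H hH => by
  obtain ⟨C, hCF, hC⟩ := h (v ⁻¹' H)
  exact ⟨C, hCF, by rw [← image_preimage_eq_inter_range, hC, image_preimage_eq_of_subset hH]⟩

theorem FiniteVCDim.exists_forall_fin_exists_preimage_ne (hF : FiniteVCDim F) :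
    ∃ d : ℕ, ∀ v : Fin d → X, ∃ σ : Set (Fin d), ∀ C ∈ F, v ⁻¹' C ≠ σ := by
  classical
  obtain ⟨d, hd⟩ := hF
  refine ⟨d, fun v => ?_⟩
  by_contra! hv
  refine hd (Finset.univ.image v) ?_ ?_
  · rw [Finset.card_image_of_injective _ (injective_of_forall_exists_preimage_eq hv),
      Finset.card_univ, Fintype.card_fin]
  · rw [Finset.coe_image, Finset.coe_univ, image_univ]
    exact shatters_range_of_forall_exists_preimage_eq hv

end Shattering

end Approx

open Approx in
theorem mainTheorem4_general {L : FirstOrder.Language.{u, v}} {U : Type w} [L.Structure U]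
    {m n : ℕ} (D : Set (Fin n → U)) (φ : L.Formula (Fin m ⊕ Fin n))
    (hφ : IsNIP U φ) (hD : ApproximableBy D φ) : ApproximableFromBelow L D := by
  suffices InnerApproximable L D D from this.approximableFromBelow
  by_contra hDD
  obtain ⟨p, hDp, hp⟩ := exists_ultrafilter_mem_and_forall_mem_not InnerApproximable.empty
    (fun _ ht _ hst => ht.mono hst) (fun _ hs _ ht => hs.union ht) hDD
  obtain ⟨d, hd⟩ := hφ.exists_forall_fin_exists_preimage_ne
  obtain ⟨v, hv⟩ := (ultrafilterPower p d).nonempty_of_mem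
    (Filter.iInter_mem.2 (hD.setOf_exists_preimage_eq_mem_ultrafilterPower hDp hp))
  obtain ⟨σ, hσ⟩ := hd v
  obtain ⟨b, hb⟩ := Set.mem_iInter.1 hv σ
  exact hσ _ ⟨b, rfl⟩ hb

theorem mainTheorem4 {L : FirstOrder.Language.{u, v}} {U : Type w} [L.Structure U]
    (hU : Approx.IsSaturated L U)
    (hκ : (Cardinal.mk U).IsInaccessible)
    (hL : Cardinal.lift.{w} L.card < Cardinal.lift.{max u v} (Cardinal.mk U))
    {m n : ℕ} (D : Set (Fin n → U)) (φ : L.Formula (Fin m ⊕ Fin n))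
    (hφ : Approx.IsNIP U φ) (hD : Approx.ApproximableBy D φ) :
    Approx.ApproximableFromBelow L D :=
  mainTheorem4_general D φ hφ hD
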